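/- The entanglement game with $k$ cops on a directed graph $G$ is played as follows. First the robber chooses a starting vertex, while the $k$ cops are outside the graph. In every turn, the cops either all stay where they are, or fly one of them to the current vertex of the robber; in both cases the robber then has to move along an edge of $G$ to a successor of his current vertex that is not occupied by a cop. The cops catch the robber if he has no such move; the robber wins if he can move forever. We say that $k$ cops suffice to catch the robber on $G$ if they have a strategy that catches him whatever he does. **Statement.** There exist a real number $\alpha>0$ and $n_0\in\mathbb{N}$ such that for every even $n\ge n_0$ there is a directed graph $G$ (without loops or parallel edges) on $6n$ vertices, in which the in-degree and the out-degree of every vertex add up to $3$, such that $\alpha n$ cops do not suffice to catch the robber on $G$; that is, no number $k\le \alpha n$ of cops suffices. -/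

import Mathlib

/-! The entanglement game on a directed graph.

The robber chooses a starting vertex; the `k` cops are outside the graph. In every turn the cops
either stay where they are or fly one of them to the current vertex of the robber; afterwards the
robber has to move along an edge to a successor of his current vertex that carries no cop. The cops
win if he cannot; the robber wins if he moves forever. -/

namespace EntanglementGame

/-- The number of edges of `G` leaving `v`. -/
noncomputable def outDegree {V : Type*} (G : Digraph V) (v : V) : ℕ :=
  {w : V | G.Adj v w}.ncard

/-- The number of edges of `G` entering `v`. -/
noncomputable def inDegree {V : Type*} (G : Digraph V) (v : V) : ℕ :=
  {u : V | G.Adj u v}.ncard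

/-- The places of the `k` cops: a vertex, or `none` for a cop outside the graph. -/
abbrev CopPlacement (V : Type*) (k : ℕ) : Type _ := Fin k → Option V

/-- The placement after a turn of the cops, when the robber is on `r`: for `none` all the cops stay
where they are, for `some i` the cop `i` flies to `r`. -/
def CopPlacement.turn {V : Type*} {k : ℕ} (c : CopPlacement V k) (r : V) :
    Option (Fin k) → CopPlacement V k
  | none => c
  | some i => Function.update c i (some r)

/-- A strategy of `k` cops: their action in a turn as a function of all the positions of the robber
up to that turn, from his starting vertex to his current vertex. The earlier placements of the cops
need not be recorded, since the strategy and the robber's positions determine them. -/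
abbrev CopStrategy (V : Type*) (k : ℕ) : Type _ := List V → Option (Fin k)

/-- The placement of the cops after `t` turns, when they follow `σ` and the robber visits
`ρ 0, ρ 1, ρ 2, …`. -/
def copsAfter {V : Type*} {k : ℕ} (σ : CopStrategy V k) (ρ : ℕ → V) : ℕ → CopPlacement V k
  | 0 => fun _ => none
  | t + 1 => (copsAfter σ ρ t).turn (ρ t) (σ ((List.range (t + 1)).map ρ))

/-- The robber can run forever along `ρ 0, ρ 1, ρ 2, …` against cops who follow `σ`: each of his
moves goes along an edge of `G` to a vertex that carries no cop at the time of the move. -/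
def Escapes {V : Type*} (G : Digraph V) {k : ℕ} (σ : CopStrategy V k) (ρ : ℕ → V) : Prop :=
  ∀ t : ℕ, G.Adj (ρ t) (ρ (t + 1)) ∧ ∀ i : Fin k, copsAfter σ ρ (t + 1) i ≠ some (ρ (t + 1))

/-- `k` cops suffice to catch the robber on `G`: they have a strategy against which no choice of a
starting vertex and of moves lets the robber run forever. -/
def CopsSuffice {V : Type*} (G : Digraph V) (k : ℕ) : Prop :=
  ∃ σ : CopStrategy V k, ∀ ρ : ℕ → V, ¬ Escapes G σ ρ

end EntanglementGame

namespace EntanglementGame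

/-! The robber keeps at least `s` vertices reachable along cop-free paths. A reachable set can be
left only through cops, so on a scale expander it jumps from `s` to more than `2 * s` vertices. It
is a union over the robber's possible moves, so halving and re-expanding finds a single move that
keeps `s` vertices reachable.

To build a scale expander, take two permutations such that no medium-sized set is nearly preserved
by both; a union bound over pairs gives them (`exists_perm_pair`). In `permDigraph`, a medium-sized
set closed up to `k` vertices has four nearly equal slices, by the cycles over each `x`, so both
permutations would nearly preserve one slice. -/

/-- Every set of at least `s` vertices that can be left only through at most `k` vertices has more
than `2 * s` vertices. -/
def IsScaleExpander {V : Type*} (G : Digraph V) (k s : ℕ) : Prop :=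
  ∀ R D : Finset V, (∀ v ∈ R, ∀ w, G.Adj v w → w ∈ R ∨ w ∈ D) → D.card ≤ k → s ≤ R.card →
    2 * s < R.card

/-- The vertices that can be reached from `S` by moves to vertices outside `X`. -/
def reach {V : Type*} (G : Digraph V) (X S : Set V) : Set V :=
  {w | ∃ v ∈ S, Relation.ReflTransGen (fun a b => G.Adj a b ∧ b ∉ X) v w}

/-- The vertices that carry a cop. -/
def CopPlacement.occupied {V : Type*} {k : ℕ} (c : CopPlacement V k) : Set V :=
  {v | ∃ i, c i = some v}

/-! ### Reachable sets and the robber's strategy -/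

section Reach

variable {V : Type*} {G : Digraph V}

theorem subset_reach (X S : Set V) : S ⊆ reach G X S :=
  fun v hv => ⟨v, hv, .refl⟩

theorem reach_insert (X S : Set V) (a : V) :
    reach G X (insert a S) = reach G X {a} ∪ reach G X S := by
  ext w
  simp [reach]

theorem reach_step {X S : Set V} {v w : V} (hv : v ∈ reach G X S) (h : G.Adj v w) :
    w ∈ reach G X S ∨ w ∈ X := by
  obtain ⟨u, hu, huv⟩ := hv
  by_cases hw : w ∈ X
  · exact .inr hw
  · exact .inl ⟨u, hu, huv.tail ⟨h, hw⟩⟩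

/-- The only vertex that can become newly blocked is `v`, and a path from `v` can be cut at its last
visit to `v`. -/
theorem reach_singleton_subset {X Y : Set V} {v : V} (hY : Y ⊆ insert v X) :
    reach G X {v} ⊆ insert v (reach G Y {w | G.Adj v w ∧ w ∉ Y}) := by
  rintro w ⟨u, rfl, h⟩
  induction h with
  | refl => exact .inl rfl
  | @tail b c _ hbc ih =>
    by_cases hc : c = u
    · exact .inl hc
    have hcY : c ∉ Y := fun h => (hY h).elim hc hbc.2
    rcases ih with rfl | ⟨x, hx, hxb⟩
    · exact .inr (subset_reach _ _ ⟨hbc.1, hcY⟩)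
    · exact .inr ⟨x, hx, hxb.tail ⟨hbc.1, hcY⟩⟩

theorem IsScaleExpander.lt_ncard_reach [Finite V] {k s : ℕ} (hG : IsScaleExpander G k s)
    {X S : Set V} (hX : X.ncard ≤ k) (hs : s ≤ (reach G X S).ncard) :
    2 * s < (reach G X S).ncard := by
  have hR := (reach G X S).toFinite
  have hD := X.toFinite
  rw [Set.ncard_eq_toFinset_card _ hR] at hs ⊢
  rw [Set.ncard_eq_toFinset_card _ hD] at hX
  refine hG hR.toFinset hD.toFinset (fun v hv w h => ?_) hX hs
  simpa using reach_step (by simpa using hv) h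

theorem IsScaleExpander.exists_le_ncard_reach [Finite V] {k s : ℕ} (hG : IsScaleExpander G k s)
    (hs0 : 0 < s) {X : Set V} (hX : X.ncard ≤ k) (S : Set V) (hs : s ≤ (reach G X S).ncard) :
    ∃ v ∈ S, s ≤ (reach G X {v}).ncard := by
  induction S, S.toFinite using Set.Finite.induction_on with
  | empty => simp [reach] at hs; omega
  | @insert a S _ _ ih =>
    -- More than `2 * s` vertices split into two parts, so one part has at least `s`; if it is the
    -- one from `S`, it expands again by induction.
    have h1 := hG.lt_ncard_reach hX hs
    rw [reach_insert] at h1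
    have h2 := Set.ncard_union_le (reach G X {a}) (reach G X S)
    rcases le_total s (reach G X {a}).ncard with h | h
    · exact ⟨a, Set.mem_insert _ _, h⟩
    · obtain ⟨v, hv, h'⟩ := ih (by omega)
      exact ⟨v, Set.mem_insert_of_mem _ hv, h'⟩

end Reach

theorem CopPlacement.ncard_occupied_le {V : Type*} {k : ℕ} (c : CopPlacement V k) :
    c.occupied.ncard ≤ k := by
  have h1 : some '' c.occupied ⊆ Set.range c := by
    rintro _ ⟨v, ⟨i, hi⟩, rfl⟩
    exact ⟨i, hi⟩
  rw [← Set.ncard_image_of_injective _ (Option.some_injective V)]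
  refine (Set.ncard_le_ncard h1 (Set.finite_range c)).trans ?_
  rw [← Set.image_univ]
  exact (Set.ncard_image_le Set.finite_univ).trans (by simp)

theorem CopPlacement.occupied_turn_subset {V : Type*} {k : ℕ} (c : CopPlacement V k) (r : V)
    (m : Option (Fin k)) : (c.turn r m).occupied ⊆ insert r c.occupied := by
  rintro v ⟨i, hi⟩
  cases m with
  | none => exact .inr ⟨i, hi⟩
  | some j =>
    by_cases hij : i = j
    · subst hij
      simp only [CopPlacement.turn, Function.update_self, Option.some.injEq] at hi
      exact .inl hi.symm
    · simp only [CopPlacement.turn, Function.update_of_ne hij] at hi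
      exact .inr ⟨i, hi⟩

/-- A robber who can keep up an invariant of his position and the placement of the cops, from one
turn to the next, is never caught. -/
theorem exists_escapes_of_invariant {V : Type*} {k : ℕ} {G : Digraph V} (σ : CopStrategy V k)
    (P : CopPlacement V k → V → Prop) (h0 : ∃ v, P (fun _ => none) v)
    (hstep : ∀ c v m, P c v → ∃ w, G.Adj v w ∧ w ∉ (c.turn v m).occupied ∧ P (c.turn v m) w) :
    ∃ ρ, Escapes G σ ρ := by
  obtain ⟨v₀, hv₀⟩ := h0
  choose! f hfA hfO hfP using hstep
  -- The third component is the history that `σ` reads.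
  let next : CopPlacement V k × V × List V → CopPlacement V k × V × List V := fun p =>
    let m := σ p.2.2
    (p.1.turn p.2.1 m, f p.1 p.2.1 m, p.2.2 ++ [f p.1 p.2.1 m])
  let st : ℕ → CopPlacement V k × V × List V := fun t => next^[t] (fun _ => none, v₀, [v₀])
  have st_succ : ∀ t, st (t + 1) = next (st t) := fun t => Function.iterate_succ_apply' _ _ _
  let ρ : ℕ → V := fun t => (st t).2.1
  have hist : ∀ t, (st t).2.2 = (List.range (t + 1)).map ρ := by
    intro t
    induction t with
    | zero => rfl
    | succ t ih =>
      rw [List.range_succ, List.map_append, ← ih, List.map_singleton]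
      simp only [ρ, st_succ, next]
  have cops : ∀ t, copsAfter σ ρ t = (st t).1 := by
    intro t
    induction t with
    | zero => rfl
    | succ t ih => rw [copsAfter, ih, ← hist, st_succ]
  have inv : ∀ t, P (st t).1 (st t).2.1 := by
    intro t
    induction t with
    | zero => exact hv₀
    | succ t ih => rw [st_succ]; exact hfP _ _ _ ih
  refine ⟨ρ, fun t => ?_⟩
  rw [cops]
  simp only [ρ, st_succ, next]
  exact ⟨hfA _ _ _ (inv t), fun i hi => hfO _ _ _ (inv t) ⟨i, hi⟩⟩

/-- On a scale expander the robber escapes by keeping at least `s` vertices reachable. -/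
theorem IsScaleExpander.not_copsSuffice {V : Type*} [Finite V] {G : Digraph V} {k s : ℕ}
    (hG : IsScaleExpander G k s) (hs0 : 0 < s) (hs : s ≤ Nat.card V) : ¬ CopsSuffice G k := by
  rintro ⟨σ, hσ⟩
  suffices ∃ ρ, Escapes G σ ρ from this.elim hσ
  refine exists_escapes_of_invariant σ (fun c v => s ≤ (reach G c.occupied {v}).ncard) ?_ ?_
  · have hle : s ≤ (reach G (CopPlacement.occupied (k := k) fun _ => none) Set.univ).ncard := by
      rw [Set.eq_univ_of_univ_subset (subset_reach (G := G) _ Set.univ), Set.ncard_univ]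
      exact hs
    obtain ⟨v, -, hv⟩ :=
      hG.exists_le_ncard_reach hs0 (CopPlacement.ncard_occupied_le _) Set.univ hle
    exact ⟨v, hv⟩
  · intro c v m hv
    have h1 := hG.lt_ncard_reach c.ncard_occupied_le hv
    have h2 := Set.ncard_le_ncard
      (reach_singleton_subset (G := G) (c.occupied_turn_subset v m)) (Set.toFinite _)
    have h3 := Set.ncard_insert_le v
      (reach G (c.turn v m).occupied {w | G.Adj v w ∧ w ∉ (c.turn v m).occupied})
    obtain ⟨w, ⟨hw, hw'⟩, hle⟩ := hG.exists_le_ncard_reach hs0 (c.turn v m).ncard_occupied_le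
      {w | G.Adj v w ∧ w ∉ (c.turn v m).occupied} (by omega)
    exact ⟨w, hw, hw', hle⟩

open Finset

/-! ### Union bound over pairs of permutations -/

section Counting

variable {α : Type*} [Fintype α]

/-- The sets with at most `t` elements. -/
def smallSets (α : Type*) [Fintype α] (t : ℕ) : Finset (Finset α) := {T | #T ≤ t}

theorem card_smallSets_mul_pow_le (t : ℕ) {x : ℝ} (hx0 : 0 ≤ x) (hx1 : x ≤ 1) :
    #(smallSets α t) * x ^ t ≤ (1 + x) ^ Fintype.card α := by
  calc (#(smallSets α t) : ℝ) * x ^ t = ∑ T ∈ smallSets α t, x ^ t := by simp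
    _ ≤ ∑ T ∈ smallSets α t, x ^ #T := sum_le_sum fun T hT =>
        pow_le_pow_of_le_one hx0 hx1 (by simpa [smallSets] using hT)
    _ ≤ ∑ T : Finset α, x ^ #T :=
        sum_le_sum_of_subset_of_nonneg (subset_univ _) fun _ _ _ => by positivity
    _ = (1 + x) ^ Fintype.card α := by
        simpa using (prod_one_add (f := fun _ : α => x) univ).symm

variable [DecidableEq α]

theorem exists_perm_image_eq {F F' : Finset α} (h : #F = #F') :
    ∃ τ : Equiv.Perm α, F.image τ = F' := by
  let e : {x // x ∈ F} ≃ {x // x ∈ F'} := Finset.equivOfCardEq h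
  refine ⟨e.extendSubtype, eq_of_subset_of_card_le (fun y hy => ?_) ?_⟩
  · obtain ⟨x, hx, rfl⟩ := mem_image.1 hy
    exact e.extendSubtype_mem x hx
  · rw [card_image_of_injective _ (Equiv.injective _), h]

/-- Left multiplication by a permutation taking one target set to another is a bijection between the
fibres of `π ↦ F.image π`. -/
theorem card_perm_image_eq_mul_choose {F F' : Finset α} (h : #F = #F') :
    #{π : Equiv.Perm α | F.image π = F'} * (Fintype.card α).choose #F = (Fintype.card α).factorial := by
  have hfib : ∀ E ∈ powersetCard #F (univ : Finset α),
      #{π : Equiv.Perm α | F.image π = E} = #{π : Equiv.Perm α | F.image π = F'} := by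
    intro E hE
    obtain ⟨τ, hτ⟩ := exists_perm_image_eq ((mem_powersetCard.1 hE).2.trans h)
    refine card_bij (fun π _ => τ * π) ?_ ?_ ?_
    · intro π hπ
      simp only [mem_filter, mem_univ, true_and] at hπ ⊢
      rw [← hτ, ← hπ, image_image]
      rfl
    · intro a _ b _ hab
      exact mul_left_cancel hab
    · intro π hπ
      refine ⟨τ⁻¹ * π, ?_, mul_inv_cancel_left _ _⟩
      simp only [mem_filter, mem_univ, true_and] at hπ ⊢
      rw [← hτ] at hπ
      apply image_injective τ.injective
      rw [← hπ, image_image]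
      congr 1
      ext x
      simp
  have hsum := card_eq_sum_card_fiberwise (f := fun π : Equiv.Perm α => F.image π)
    (s := univ) (t := powersetCard #F univ) (by
      intro π _
      simp [card_image_of_injective _ π.injective])
  rw [sum_congr rfl hfib, sum_const, card_powersetCard, card_univ, card_univ,
    Fintype.card_perm, smul_eq_mul] at hsum
  rw [hsum, mul_comm]

/-- `E` is determined by `E \ F` and `F \ E`, which have equal size. -/
theorem card_near_le (F : Finset α) (t : ℕ) :
    #{E : Finset α | #F = #E ∧ #(E \ F) ≤ t} ≤ #(smallSets α t) ^ 2 := by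
  rw [sq, ← card_product]
  refine card_le_card_of_injOn (fun E => (E \ F, F \ E)) ?_ ?_
  · intro E hE
    simp only [coe_filter, mem_univ, true_and, Set.mem_ofPred_eq] at hE
    have := card_sdiff_comm hE.1
    simp [smallSets, this, hE.2]
  · intro E _ E' _ h
    simp only [Prod.mk.injEq, Finset.ext_iff, mem_sdiff] at h
    ext x
    have h1 := h.1 x
    have h2 := h.2 x
    tauto

theorem card_perm_near_mul_choose_le (F : Finset α) (t : ℕ) :
    #{π : Equiv.Perm α | #(F.image π \ F) ≤ t} * (Fintype.card α).choose #F ≤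
      (Fintype.card α).factorial * #(smallSets α t) ^ 2 := by
  have hsum := card_eq_sum_card_fiberwise (f := fun π : Equiv.Perm α => F.image π)
    (s := {π : Equiv.Perm α | #(F.image π \ F) ≤ t})
    (t := {E : Finset α | #F = #E ∧ #(E \ F) ≤ t}) (by
      intro π hπ
      simpa [card_image_of_injective _ π.injective] using hπ)
  rw [hsum, sum_mul]
  refine (sum_le_card_nsmul _ _ (Fintype.card α).factorial fun E hE => ?_).trans ?_
  · rw [← card_perm_image_eq_mul_choose (mem_filter.1 hE).2.1]
    gcongr
    exact subset_univ _
  · rw [smul_eq_mul, mul_comm]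
    exact Nat.mul_le_mul_left _ (card_near_le F t)

theorem choose_le_choose_of_le_half {m i j : ℕ} (hij : i ≤ j) (hj : j ≤ m / 2) :
    m.choose i ≤ m.choose j := by
  induction j, hij using Nat.le_induction with
  | base => rfl
  | succ j _ ih => exact (ih (by omega)).trans (Nat.choose_le_succ_of_lt_half_left (by omega))

/-- A counting argument: some pair of permutations has no set `F` of medium size which both of them
nearly preserve. -/
theorem exists_perm_pair (a b t : ℕ) (hb : b ≤ Fintype.card α / 2)
    (hP : (b + 1) * #(smallSets α t) ^ 4 < (Fintype.card α).choose a) :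
    ∃ π : Bool → Equiv.Perm α, ∀ F : Finset α, a ≤ #F → #F ≤ b → ∃ i, t < #(F.image (π i) \ F) := by
  by_contra! hcon
  set m := Fintype.card α with hm
  set P := #(smallSets α t)
  let N : Finset α → Finset (Equiv.Perm α) := fun F => {π | #(F.image π \ F) ≤ t}
  let M : Finset (Finset α) := {F | a ≤ #F ∧ #F ≤ b}
  have hcover : (univ : Finset (Equiv.Perm α × Equiv.Perm α)) ⊆ M.biUnion fun F => N F ×ˢ N F := by
    intro p _
    obtain ⟨F, h1, h2, h3⟩ := hcon fun i => cond i p.1 p.2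
    simp only [M, N, mem_biUnion, mem_product, mem_filter, mem_univ, true_and]
    exact ⟨F, ⟨h1, h2⟩, h3 true, h3 false⟩
  have hcard : m.factorial ^ 2 ≤ ∑ F ∈ M, #(N F) ^ 2 := by
    have := (card_le_card hcover).trans card_biUnion_le
    simpa [Fintype.card_perm, card_product, sq] using this
  have hfac : (0 : ℝ) < m.factorial := by positivity
  have hca : 0 < m.choose a := by omega
  have hterm : ∀ F ∈ M, (#(N F) : ℝ) ^ 2 ≤ (m.factorial * P ^ 2) ^ 2 / m.choose #F ^ 2 := by
    intro F hF
    have hF' := (mem_filter.1 hF).2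
    have hc : (0 : ℝ) < m.choose #F := by
      exact_mod_cast hca.trans_le (choose_le_choose_of_le_half hF'.1 (hF'.2.trans hb))
    rw [le_div_iff₀ (by positivity), ← mul_pow]
    exact pow_le_pow_left₀ (by positivity)
      (by exact_mod_cast card_perm_near_mul_choose_le F t) 2
  -- The square, from having two permutations, outweighs the `m.choose j` sets of size `j`: each
  -- level contributes at most `1 / m.choose a`.
  have hlevel : ∑ F ∈ M, (1 : ℝ) / m.choose #F ^ 2 ≤ (b + 1) / m.choose a := by
    have hmaps : ∀ F ∈ M, #F ∈ Icc a b := fun F hF => mem_Icc.2 (mem_filter.1 hF).2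
    rw [← sum_fiberwise_of_maps_to hmaps]
    have hj : ∀ j ∈ Icc a b, ∑ F ∈ M with #F = j, (1 : ℝ) / m.choose #F ^ 2 ≤ 1 / m.choose a := by
      intro j hj
      have hj' := mem_Icc.1 hj
      have hle := choose_le_choose_of_le_half hj'.1 (hj'.2.trans hb)
      have hc : (0 : ℝ) < m.choose a := by exact_mod_cast hca
      have hc' : (0 : ℝ) < m.choose j := by exact_mod_cast hca.trans_le hle
      have hsub : #{F ∈ M | #F = j} ≤ m.choose j := by
        rw [hm, ← card_univ, ← card_powersetCard]
        refine card_le_card fun F hF => ?_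
        simpa using (mem_filter.1 hF).2
      calc ∑ F ∈ M with #F = j, (1 : ℝ) / m.choose #F ^ 2
          = ∑ F ∈ M with #F = j, (1 : ℝ) / m.choose j ^ 2 :=
            sum_congr rfl fun F hF => by rw [(mem_filter.1 hF).2]
        _ = #{F ∈ M | #F = j} * (1 / (m.choose j : ℝ) ^ 2) := by simp
        _ ≤ m.choose j * (1 / (m.choose j : ℝ) ^ 2) := by gcongr
        _ = 1 / m.choose j := by field_simp
        _ ≤ 1 / m.choose a := by gcongr
    refine (sum_le_card_nsmul _ _ _ hj).trans ?_
    rw [nsmul_eq_mul, Nat.card_Icc, mul_one_div]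
    gcongr
    exact_mod_cast Nat.sub_le _ _
  have h1 : (m.factorial : ℝ) ^ 2 ≤ (m.factorial * P ^ 2) ^ 2 * ((b + 1) / m.choose a) := by
    calc (m.factorial : ℝ) ^ 2 ≤ ∑ F ∈ M, (#(N F) : ℝ) ^ 2 := by exact_mod_cast hcard
      _ ≤ ∑ F ∈ M, (m.factorial * P ^ 2 : ℝ) ^ 2 * (1 / m.choose #F ^ 2) :=
        sum_le_sum fun F hF => by rw [mul_one_div]; exact hterm F hF
      _ ≤ _ := by rw [← mul_sum]; gcongr
  have h2 : (m.choose a : ℝ) ≤ (b + 1) * P ^ 4 := by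
    have hc : (0 : ℝ) < m.choose a := by exact_mod_cast hca
    rw [← mul_div_assoc, le_div_iff₀ hc] at h1
    refine le_of_mul_le_mul_left (h1.trans_eq ?_) (pow_pos hfac 2)
    ring
  have h3 : m.choose a ≤ (b + 1) * P ^ 4 := by exact_mod_cast h2
  omega

end Counting

/-! ### Numerical estimates -/

theorem mul_self_lt_two_pow {a : ℕ} (ha : 20 ≤ a) : a * (3 * a + 1) < 2 ^ a := by
  induction a, ha using Nat.le_induction with
  | base => norm_num
  | succ a ha ih => rw [pow_succ]; nlinarith

theorem card_smallSets_pow_four_le {m a t : ℕ} (hm : m ≤ 9 * a) (ht : 101 * t ≤ a) :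
    #(smallSets (Fin m) t) ^ 4 ≤ 2 ^ a := by
  have h := card_smallSets_mul_pow_le (α := Fin m) t (x := 1 / 100) (by norm_num) (by norm_num)
  rw [Fintype.card_fin, one_div, inv_pow, ← div_eq_mul_inv, div_le_iff₀ (by positivity)] at h
  have h1 : ((1 + 1 / 100 : ℝ)) ^ m ≤ ((1 + 1 / 100) ^ 9) ^ a := by
    rw [← pow_mul]
    exact pow_le_pow_right₀ (by norm_num) hm
  have h2 : (100 : ℝ) ^ t ≤ (1047 / 1000) ^ a :=
    calc (100 : ℝ) ^ t ≤ ((1047 / 1000) ^ 101) ^ t := by gcongr; norm_num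
      _ ≤ (1047 / 1000) ^ a := by
        rw [← pow_mul]
        exact pow_le_pow_right₀ (by norm_num) (by omega)
  have h3 : (#(smallSets (Fin m) t) : ℝ) ^ 4 ≤ 2 ^ a := by
    calc (#(smallSets (Fin m) t) : ℝ) ^ 4
        ≤ (((1 + 1 / 100) ^ 9) ^ a * (1047 / 1000) ^ a) ^ 4 := by
          gcongr
          refine h.trans ?_
          rw [← one_div]
          gcongr
      _ = (((1 + 1 / 100) ^ 9 * (1047 / 1000)) ^ 4) ^ a := by
          rw [← mul_pow, ← pow_mul, ← pow_mul, mul_comm 4 a]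
      _ ≤ 2 ^ a := by gcongr; norm_num
  exact_mod_cast h3

theorem exists_expanding_perm_pair {m a t : ℕ} (ha : 20 ≤ a) (ham : 8 * a ≤ m) (hma : m ≤ 9 * a)
    (ht : 101 * t ≤ a) :
    ∃ π : Bool → Equiv.Perm (Fin m), ∀ F : Finset (Fin m), a ≤ #F → #F ≤ 3 * a →
      ∃ i, t < #(F.image (π i) \ F) := by
  refine exists_perm_pair a (3 * a) t (by rw [Fintype.card_fin]; omega) ?_
  rw [Fintype.card_fin]
  -- Of the `4 ^ a` supplied by the central binomial coefficient, one `2 ^ a` pays for the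
  -- polynomial factor and one for the small sets.
  have h1 := Nat.four_pow_lt_mul_centralBinom a (by omega)
  have h2 : a.centralBinom ≤ m.choose a := Nat.choose_le_choose a (by omega)
  have h3 := mul_self_lt_two_pow ha
  have h4 := card_smallSets_pow_four_le (m := m) (a := a) (t := t) hma (by omega)
  have h5 : (4 : ℕ) ^ a = 2 ^ a * 2 ^ a := by rw [← mul_pow]; norm_num
  refine lt_of_mul_lt_mul_left (a := a) ?_ (Nat.zero_le _)
  calc a * ((3 * a + 1) * #(smallSets (Fin m) t) ^ 4)
      = (a * (3 * a + 1)) * #(smallSets (Fin m) t) ^ 4 := by ring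
    _ ≤ 2 ^ a * 2 ^ a := Nat.mul_le_mul h3.le h4
    _ < a * a.centralBinom := h5 ▸ h1
    _ ≤ a * m.choose a := Nat.mul_le_mul_left _ h2

/-- The digraph with vertices `(x, b, c)`, where `c` is `false` for entries and `true` for exits.
For every `x` there is the cycle through entry and exit of `(x, false)` and of `(x, true)`, and
the exit of `(x, b)` has another edge to the entry of `(π b x, b)`. -/
def permDigraph {α : Type*} (π : Bool → Equiv.Perm α) : Digraph (α × Bool × Bool) where
  Adj
    | (x, b, false), w => w = (x, b, true)
    | (x, b, true), w => w = (x, !b, false) ∨ w = (π b x, b, false)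

theorem card_sdiff_le_add {α : Type*} [DecidableEq α] (A B C : Finset α) : #(A \ C) ≤ #(A \ B) + #(B \ C) :=
  (card_le_card (sdiff_triangle A B C)).trans (card_union_le _ _)

theorem card_le_add_sdiff {α : Type*} [DecidableEq α] (A B : Finset α) : #A ≤ #B + #(A \ B) := by
  have := card_le_card_sdiff_add_card (s := A) (t := B)
  omega

/-! ### Degrees and expansion of the digraph -/

section PermDigraph

variable {α : Type*} (π : Bool → Equiv.Perm α)

theorem permDigraph_adj_entry {x : α} {b : Bool} {w : α × Bool × Bool} :
    (permDigraph π).Adj (x, b, false) w ↔ w = (x, b, true) := Iff.rfl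

theorem permDigraph_adj_exit {x : α} {b : Bool} {w : α × Bool × Bool} :
    (permDigraph π).Adj (x, b, true) w ↔ w = (x, !b, false) ∨ w = (π b x, b, false) := Iff.rfl

theorem permDigraph_loopless (v : α × Bool × Bool) : ¬ (permDigraph π).Adj v v := by
  obtain ⟨x, b, _ | _⟩ := v
  · simp [permDigraph_adj_entry]
  · simp [permDigraph_adj_exit]

theorem permDigraph_degree (v : α × Bool × Bool) :
    inDegree (permDigraph π) v + outDegree (permDigraph π) v = 3 := by
  obtain ⟨x, b, _ | _⟩ := v
  · have hin : {u | (permDigraph π).Adj u (x, b, false)} =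
        {(x, !b, true), ((π b).symm x, b, true)} := by
      ext ⟨y, b', _ | _⟩
      · simp [permDigraph_adj_entry]
      · simp only [Set.mem_ofPred_eq, permDigraph_adj_exit, Set.mem_insert_iff,
          Set.mem_singleton_iff, Prod.mk.injEq, and_true]
        refine or_congr ?_ ?_
        · cases b <;> cases b' <;> simp [eq_comm]
        · constructor
          · rintro ⟨rfl, rfl⟩
            simp
          · rintro ⟨rfl, rfl⟩
            simp
    have hout : {w | (permDigraph π).Adj (x, b, false) w} = {(x, b, true)} := by
      ext w
      simp [permDigraph_adj_entry]
    rw [inDegree, outDegree, hin, hout, Set.ncard_pair (by simp), Set.ncard_singleton]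
  · have hin : {u | (permDigraph π).Adj u (x, b, true)} = {(x, b, false)} := by
      ext ⟨y, b', _ | _⟩
      · simp [permDigraph_adj_entry, eq_comm]
      · simp [permDigraph_adj_exit]
    have hout : {w | (permDigraph π).Adj (x, b, true) w} =
        {(x, !b, false), (π b x, b, false)} := by
      ext w
      simp [permDigraph_adj_exit]
    rw [inDegree, outDegree, hin, hout, Set.ncard_pair (by simp), Set.ncard_singleton]

variable [Fintype α] [DecidableEq α]

/-- The `x` for which `(x, b, c)` belongs to `R`. -/
def slice (R : Finset (α × Bool × Bool)) (b c : Bool) : Finset α := {x | (x, b, c) ∈ R}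

theorem mem_slice {R : Finset (α × Bool × Bool)} {b c : Bool} {x : α} :
    x ∈ slice R b c ↔ (x, b, c) ∈ R := by
  simp [slice]

theorem card_slice_le (R : Finset (α × Bool × Bool)) (b c : Bool) : #(slice R b c) ≤ #R :=
  card_le_card_of_injOn (fun x => (x, b, c)) (fun _ hx => mem_slice.1 hx)
    fun _ _ _ _ h => congrArg Prod.fst h

theorem card_eq_sum_slices (R : Finset (α × Bool × Bool)) :
    #R = #(slice R false false) + #(slice R false true) + #(slice R true false) +
      #(slice R true true) := by
  have h : #R = ∑ v : α × Bool × Bool, if v ∈ R then 1 else 0 := by simp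
  rw [h]
  simp only [Fintype.sum_prod_type, Fintype.sum_bool, sum_add_distrib, slice, card_filter]
  ring

theorem permDigraph_isScaleExpander {k a t : ℕ} (hk : 6 * k ≤ t) (ht : t ≤ a)
    (hπ : ∀ F : Finset α, a ≤ #F → #F ≤ 3 * a → ∃ i, t < #(F.image (π i) \ F)) :
    IsScaleExpander (permDigraph π) k (4 * a + t) := by
  intro R D hRD hD hs
  by_contra! hlt
  have entry : ∀ b, #(slice R b false \ slice R b true) ≤ k := fun b => by
    refine (card_le_card fun x hx => ?_).trans ((card_slice_le D b true).trans hD)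
    rw [mem_sdiff, mem_slice, mem_slice] at hx
    exact mem_slice.2 ((hRD _ hx.1 _ rfl).resolve_left hx.2)
  have exit_swap : ∀ b, #(slice R b true \ slice R (!b) false) ≤ k := fun b => by
    refine (card_le_card fun x hx => ?_).trans ((card_slice_le D (!b) false).trans hD)
    rw [mem_sdiff, mem_slice, mem_slice] at hx
    exact mem_slice.2 ((hRD _ hx.1 _ (.inl rfl)).resolve_left hx.2)
  have exit_perm : ∀ b, #((slice R b true).image (π b) \ slice R b false) ≤ k := fun b => by
    refine (card_le_card fun y hy => ?_).trans ((card_slice_le D b false).trans hD)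
    rw [mem_sdiff, mem_image, mem_slice] at hy
    obtain ⟨⟨x, hx, rfl⟩, hy⟩ := hy
    exact mem_slice.2 ((hRD _ (mem_slice.1 hx) _ (.inr rfl)).resolve_left hy)
  have hcard := card_eq_sum_slices R
  have e0 := entry false
  have e1 := entry true
  have s0 := exit_swap false
  have s1 := exit_swap true
  have p0 := exit_perm false
  have p1 := exit_perm true
  simp only [Bool.not_false, Bool.not_true] at s0 s1
  set A₀ := slice R false false
  set A₁ := slice R true false
  set B₀ := slice R false true
  set B₁ := slice R true true
  have c1 := card_le_add_sdiff A₀ B₀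
  have c2 := card_le_add_sdiff A₁ B₁
  have c3 := card_le_add_sdiff B₀ A₁
  have c4 := card_le_add_sdiff B₁ A₀
  -- Around the cycle `A₀, B₀, A₁, B₁` sizes drop by at most `k` per step, so `4 * #B₀` differs from
  -- `#R` by at most `6 * k ≤ t`.
  obtain ⟨i, hi⟩ := hπ B₀ (by omega) (by omega)
  cases i with
  | false =>
    have d1 := card_sdiff_le_add (B₀.image (π false)) A₀ B₀
    omega
  | true =>
    -- `π true` acts on `B₁`, so `B₀` is exchanged for `B₁` and back; the losses total `6 * k`.
    have d1 := card_sdiff_le_add (B₀.image (π true)) (B₁.image (π true)) B₀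
    have d2 := card_sdiff_le_add (B₁.image (π true)) A₁ B₀
    have d3 := card_sdiff_le_add A₁ B₁ B₀
    have d4 := card_sdiff_le_add B₁ A₀ B₀
    have d5 := card_sdiff_le_add B₀ A₁ B₁
    have d6 : #(B₀.image (π true) \ B₁.image (π true)) = #(B₀ \ B₁) := by
      rw [← image_sdiff _ _ (π true).injective, card_image_of_injective _ (π true).injective]
    omega

end PermDigraph

end EntanglementGame

theorem mainTheorem7 :
    ∃ α : ℝ, 0 < α ∧ ∃ n₀ : ℕ, ∀ n : ℕ, n₀ ≤ n → Even n →
      ∃ (V : Type) (_ : Fintype V) (G : Digraph V),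
        Fintype.card V = 6 * n ∧
        (∀ v : V, ¬ G.Adj v v) ∧
        (∀ v : V, EntanglementGame.inDegree G v + EntanglementGame.outDegree G v = 3) ∧
        ∀ k : ℕ, (k : ℝ) ≤ α * (n : ℝ) → ¬ EntanglementGame.CopsSuffice G k := by
  refine ⟨1 / 10000, by norm_num, 100000, fun n hn hev => ?_⟩
  obtain ⟨r, rfl⟩ := hev
  -- With `n = r + r`, the `4 * (3 * r)` vertices number `6 * n`.
  obtain ⟨π, hπ⟩ := EntanglementGame.exists_expanding_perm_pair (m := 3 * r) (a := 3 * r / 8)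
    (t := 3 * r / 8 / 101) (by omega) (by omega) (by omega) (by omega)
  refine ⟨Fin (3 * r) × Bool × Bool, inferInstance, EntanglementGame.permDigraph π, ?_,
    EntanglementGame.permDigraph_loopless π, EntanglementGame.permDigraph_degree π,
    fun k hk => ?_⟩
  · simp only [Fintype.card_prod, Fintype.card_fin, Fintype.card_bool]
    ring
  · have hk' : 10000 * k ≤ r + r := by
      have : (10000 : ℝ) * k ≤ (r + r : ℕ) := by linarith
      exact_mod_cast this
    refine (EntanglementGame.permDigraph_isScaleExpander π (k := k) (by omega) (by omega)
      hπ).not_copsSuffice (by omega) ?_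
    simp only [Nat.card_eq_fintype_card, Fintype.card_prod, Fintype.card_fin, Fintype.card_bool]
    omega
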